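/- Let $n \ge 0$ and let $S_n$ be the group of permutations of $[n]=\{1,\dots,n\}$, with adjacent transpositions $s_i=(i\ \,i{+}1)$ for $1\le i\le n-1$. Let $\mathsf{TL}_n(2)$ be the Temperley--Lieb algebra, i.e. the unital associative $\mathbb{C}$-algebra with generators $e_1,\dots,e_{n-1}$ and relations $e_i^2=2e_i$; $e_ie_j=e_je_i$ if $|i-j|>1$; and $e_ie_je_i=e_i$ if $|i-j|=1$ (for $1\le i,j\le n-1$). A noncrossing partition of size $n$ is a set $\lambda$ of arcs $(i,j)$ with $1\le i<j\le n$ that contains no two distinct arcs $(i,k)$, $(j,l)$ with $i\le j<k\le l$. Let $\lambda^+$ be the set of left endpoints $i$ and $\lambda^-$ the set of right endpoints $j$ of the arcs $(i,j)\in\lambda$. For $w\in S_n$ put $E_{pos}(w)=\{i : i\le w_i\}$ and $E_{val}(w)=\{w_i : i\le w_i\}$, and define the excedance class of $\lambda$ to be $$\mathcal{C}_\lambda=\{w\in S_n : E_{val}(w)=[n]\setminus\lambda^+ \text{ and } E_{pos}(w)=[n]\setminus\lambda^-\}.$$ There is a unique $\mathbb{C}$-algebra homomorphism $\phi:\mathbb{C}S_n\to\mathsf{TL}_n(2)$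 with $\phi(s_i)=1-e_i$ for $1\le i\le n-1$, and it is surjective. Moreover, if for each noncrossing partition $\lambda$ of size $n$ an element $w_\lambda\in\mathcal{C}_\lambda$ is fixed, then the elements $\phi(w_\lambda)$, indexed by the noncrossing partitions $\lambda$ of size $n$, form a basis of $\mathsf{TL}_n(2)$ as a complex vector space. -/

import Mathlib

namespace TemperleyLieb

/-- The defining relations of the Temperley-Lieb algebra at loop parameter `2`.  The generators
`e_1, ..., e_{n-1}` are indexed by `Fin (n - 1)`, the index `i` standing for `e_{i+1}`. -/
inductive Rel (n : ℕ) :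
    FreeAlgebra ℂ (Fin (n - 1)) → FreeAlgebra ℂ (Fin (n - 1)) → Prop
  | sq (i : Fin (n - 1)) :
      Rel n (FreeAlgebra.ι ℂ i * FreeAlgebra.ι ℂ i) ((2 : ℂ) • FreeAlgebra.ι ℂ i)
  | comm (i j : Fin (n - 1)) (h : (i : ℕ) + 1 < j ∨ (j : ℕ) + 1 < i) :
      Rel n (FreeAlgebra.ι ℂ i * FreeAlgebra.ι ℂ j) (FreeAlgebra.ι ℂ j * FreeAlgebra.ι ℂ i)
  | braid (i j : Fin (n - 1)) (h : (i : ℕ) + 1 = j ∨ (j : ℕ) + 1 = i) :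
      Rel n (FreeAlgebra.ι ℂ i * FreeAlgebra.ι ℂ j * FreeAlgebra.ι ℂ i) (FreeAlgebra.ι ℂ i)

/-- The Temperley-Lieb algebra `TL_n(2)` over `ℂ`, by generators and relations. -/
abbrev TL (n : ℕ) : Type := RingQuot (Rel n)

/-- The generators of `TL_n(2)`. -/
noncomputable def e {n : ℕ} (i : Fin (n - 1)) : TL n :=
  RingQuot.mkAlgHom ℂ (Rel n) (FreeAlgebra.ι ℂ i)

/-- The adjacent transpositions of `S_n = Equiv.Perm (Fin n)`. -/
def s {n : ℕ} (i : Fin (n - 1)) : Equiv.Perm (Fin n) :=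
  Equiv.swap ⟨(i : ℕ), by omega⟩ ⟨(i : ℕ) + 1, by omega⟩

/-- A noncrossing partition of size `n`, given by its arcs `(i, j)`, `i < j`: no two distinct
arcs `(i, k)`, `(j, l)` satisfy `i ≤ j < k ≤ l`. -/
structure NCP (n : ℕ) where
  arcs : Finset (Fin n × Fin n)
  lt_of_mem : ∀ a ∈ arcs, a.1 < a.2
  noncrossing : ∀ a ∈ arcs, ∀ b ∈ arcs, a ≠ b → ¬ (a.1 ≤ b.1 ∧ b.1 < a.2 ∧ a.2 ≤ b.2)

/-- The set of left endpoints of arcs. -/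
def NCP.left {n : ℕ} (p : NCP n) : Finset (Fin n) := p.arcs.image Prod.fst

/-- The set of right endpoints of arcs. -/
def NCP.right {n : ℕ} (p : NCP n) : Finset (Fin n) := p.arcs.image Prod.snd

/-- The positions of the weak excedances of `w`. -/
def excPos {n : ℕ} (w : Equiv.Perm (Fin n)) : Finset (Fin n) :=
  Finset.univ.filter fun i => i ≤ w i

/-- The values of the weak excedances of `w`. -/
def excVal {n : ℕ} (w : Equiv.Perm (Fin n)) : Finset (Fin n) :=
  (excPos w).image w

/-- The excedance class determined by a noncrossing partition. -/
def excClass {n : ℕ} (p : NCP n) : Set (Equiv.Perm (Fin n)) :=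
  {w | excVal w = p.leftᶜ ∧ excPos w = p.rightᶜ}

end TemperleyLieb

open Equiv

/-! Put S = 1 - e_i and T = 1 - e_j for neighbours i, j. Then e_i e_j e_i = e_i says exactly that
the antisymmetrizer 1 - S - T + ST + TS - STS vanishes. This forces the braid relation, so the
Coxeter presentation of S_n gives φ; it is surjective because e_i = φ(1 - s_i).

Upper bound on the dimension: conjugates of the vanishing antisymmetrizer rewrite any permutation
with a 321 pattern, so the 321-avoiding ones span (`span_permToTL_avoids321`). Such a permutation is
determined by its weak excedance positions and values, hence by its class, so the dimension is at
most the number of noncrossing partitions.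

Independence: S_n acts on functions on subsets of [n], that is on (ℂ²)^{⊗n}. Antisymmetrizers on
three letters vanish there, so the action factors through TL_n(2). Testing whether `w p` carries the
complement of q's right endpoints to the complement of its left endpoints gives 1 for p = q, and 0
unless `q.excess ≤ p.excess`. This triangularity is `linearIndependent_fromPerm`. -/

/-! ### Coxeter presentation of the symmetric group -/

theorem Equiv.Perm.exists_succAbove {n : ℕ} (w : Perm (Fin (n + 1))) :
    ∃ v : Perm (Fin n), ∀ j, w j.succ = (w 0).succAbove (v j) := by
  obtain ⟨⟨p, v⟩, hv⟩ := Perm.decomposeFin.symm.surjective ((w 0).cycleRange * w)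
  have hp : p = 0 := by
    have := congrArg (fun u : Perm (Fin (n + 1)) => u 0) hv
    simpa using this
  refine ⟨v, fun j => ?_⟩
  have := congrArg (fun u : Perm (Fin (n + 1)) => u j.succ) hv
  simp only [hp, Perm.decomposeFin_symm_apply_succ, swap_self, refl_apply, Perm.mul_apply] at this
  rw [← Fin.cycleRange_symm_succ, this, symm_apply_apply]

/-- The permutation of `Fin n` obtained from `w` by deleting the position `0` and the value `w 0`
and standardizing. -/
noncomputable def Equiv.Perm.deleteZero {n : ℕ} (w : Perm (Fin (n + 1))) : Perm (Fin n) :=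
  w.exists_succAbove.choose

theorem Equiv.Perm.apply_succ_eq_succAbove {n : ℕ} (w : Perm (Fin (n + 1))) (j : Fin n) :
    w j.succ = (w 0).succAbove (w.deleteZero j) :=
  w.exists_succAbove.choose_spec j

theorem Equiv.Perm.deleteZero_eq {n : ℕ} {w : Perm (Fin (n + 1))} {k : Fin (n + 1)}
    {v : Perm (Fin n)} (hk : w 0 = k) (h : ∀ j, w j.succ = k.succAbove (v j)) :
    w.deleteZero = v := by
  ext1 j
  have := w.apply_succ_eq_succAbove j
  rw [h, hk] at this
  exact (Fin.succAbove_right_injective this).symm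

theorem Fin.val_succAbove {n : ℕ} (k : Fin (n + 1)) (m : Fin n) :
    (k.succAbove m : ℕ) = if (m : ℕ) < k then (m : ℕ) else m + 1 := by
  simp only [Fin.succAbove, Fin.lt_def, Fin.val_castSucc]
  split_ifs <;> simp

theorem Fin.val_swap_succ {n i : ℕ} (h : i + 1 < n) (x : Fin n) :
    (swap (⟨i, by omega⟩ : Fin n) ⟨i + 1, h⟩ x : ℕ) =
      if (x : ℕ) = i then i + 1 else if (x : ℕ) = i + 1 then i else x := by
  simp only [swap_apply_def, Fin.ext_iff]
  split_ifs <;> simp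

/-- The product `t (k - 1) * ⋯ * t 1 * t 0`. -/
def descProd {M : Type*} [Monoid M] (t : ℕ → M) : ℕ → M
  | 0 => 1
  | k + 1 => t k * descProd t k

section

variable {M : Type*} [Monoid M] {t : ℕ → M}

theorem descProd_comm {n i : ℕ} (hcomm : ∀ i j, i + 1 < j → j + 1 < n → t i * t j = t j * t i)
    (hi : i + 1 < n) : ∀ k, k < i → t i * descProd t k = descProd t k * t i
  | 0, _ => by simp [descProd]
  | k + 1, hk => by
    rw [descProd, ← mul_assoc, ← hcomm k i hk hi, mul_assoc,
      descProd_comm hcomm hi k (by omega), mul_assoc]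

theorem mul_descProd {n i : ℕ} (hcomm : ∀ i j, i + 1 < j → j + 1 < n → t i * t j = t j * t i)
    (hbraid : ∀ i, i + 2 < n → t i * t (i + 1) * t i = t (i + 1) * t i * t (i + 1)) :
    ∀ k, i + 1 < k → k < n → t i * descProd t k = descProd t k * t (i + 1)
  | 0, h, _ => by omega
  | k + 1, h, hk => by
    rcases Nat.lt_or_ge (i + 1) k with h' | h'
    · rw [descProd, ← mul_assoc, hcomm i k h' hk, mul_assoc,
        mul_descProd hcomm hbraid k h' (by omega), mul_assoc]
    · obtain rfl : k = i + 1 := by omega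
      rw [descProd, descProd, ← mul_assoc, ← mul_assoc, hbraid i hk, mul_assoc,
        descProd_comm hcomm hk i (by omega), ← mul_assoc, ← mul_assoc]

/-- Induction on n through the normal form w = s_{k-1} ⋯ s_0 · v, where k = w 0 and v fixes 0. The
value prescribed by this form is shown to be compatible with left multiplication by each generator,
and the generators suffice. -/
theorem Equiv.Perm.exists_monoidHom_of_braid : ∀ (n : ℕ) (t : ℕ → M),
    (∀ i, i + 1 < n → t i * t i = 1) →
    (∀ i j, i + 1 < j → j + 1 < n → t i * t j = t j * t i) →
    (∀ i, i + 2 < n → t i * t (i + 1) * t i = t (i + 1) * t i * t (i + 1)) →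
    ∃ f : Perm (Fin n) →* M,
      ∀ i (h : i + 1 < n), f (swap ⟨i, by omega⟩ ⟨i + 1, h⟩) = t i
  | 0, _, _, _, _ => ⟨1, fun _ h => by omega⟩
  | n + 1, t, hsq, hcomm, hbraid => by
    obtain ⟨f, hf⟩ := exists_monoidHom_of_braid n (fun i => t (i + 1))
      (fun i hi => hsq _ (by omega)) (fun i j hi hj => hcomm _ _ (by omega) (by omega))
      (fun i hi => hbraid _ (by omega))
    let F : Perm (Fin (n + 1)) → M := fun w => descProd t (w 0) * f w.deleteZero
    have hF1 : F 1 = 1 := by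
      have : (1 : Perm (Fin (n + 1))).deleteZero = 1 :=
        Perm.deleteZero_eq (k := 0) rfl fun j => by simp
      simp [F, this, descProd]
    have key : ∀ i (h : i + 1 < n + 1) (w : Perm (Fin (n + 1))),
        F (swap ⟨i, by omega⟩ ⟨i + 1, h⟩ * w) = t i * F w := by
      intro i h w
      have h0 := Fin.val_swap_succ h (w 0)
      rw [← Perm.mul_apply] at h0
      have hw := w.apply_succ_eq_succAbove
      generalize hk : w 0 = k at h0 hw
      generalize hu : swap ⟨i, by omega⟩ ⟨i + 1, h⟩ * w = u at h0
      have hus : ∀ j, (u j.succ : ℕ) = if (k.succAbove (w.deleteZero j) : ℕ) = i then i + 1 else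
          if (k.succAbove (w.deleteZero j) : ℕ) = i + 1 then i else
            k.succAbove (w.deleteZero j) := by
        intro j
        rw [← hw, ← Fin.val_swap_succ h, ← hu, Perm.mul_apply]
      simp only [Fin.val_succAbove] at hus
      simp only [F, hk]
      -- If k is i or i + 1, the swap only moves the value at position 0. Otherwise it acts on the
      -- deleted permutation, with index lowered by one when k < i; the shift in `hf` then calls for
      -- t i or t (i + 1), as the two commutation lemmas supply.
      by_cases h1 : (k : ℕ) = i
      · have : u.deleteZero = w.deleteZero := by
          refine Perm.deleteZero_eq rfl fun j => Fin.ext ?_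
          rw [hus, Fin.val_succAbove, h0]
          split_ifs <;> omega
        rw [this, h0, if_pos h1, h1, descProd, mul_assoc]
      by_cases h2 : (k : ℕ) = i + 1
      · have : u.deleteZero = w.deleteZero := by
          refine Perm.deleteZero_eq rfl fun j => Fin.ext ?_
          rw [hus, Fin.val_succAbove, h0]
          split_ifs <;> omega
        rw [this, h0, if_neg h1, if_pos h2, h2, descProd, ← mul_assoc, ← mul_assoc,
          hsq i h, one_mul]
      rw [if_neg h1, if_neg h2] at h0
      rcases Nat.lt_or_ge (k : ℕ) i with h3 | h3
      · obtain ⟨i, rfl⟩ : ∃ m, i = m + 1 := ⟨i - 1, by omega⟩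
        have : u.deleteZero = swap ⟨i, by omega⟩ ⟨i + 1, by omega⟩ * w.deleteZero := by
          refine Perm.deleteZero_eq rfl fun j => Fin.ext ?_
          rw [hus, Fin.val_succAbove, h0, Perm.mul_apply, Fin.val_swap_succ]
          split_ifs <;> omega
        rw [this, h0, map_mul, hf i (by omega), ← mul_assoc, ← mul_assoc,
          descProd_comm hcomm h k h3]
      · have hkn := k.isLt
        have : u.deleteZero = swap ⟨i, by omega⟩ ⟨i + 1, by omega⟩ * w.deleteZero := by
          refine Perm.deleteZero_eq rfl fun j => Fin.ext ?_
          rw [hus, Fin.val_succAbove, h0, Perm.mul_apply, Fin.val_swap_succ]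
          split_ifs <;> omega
        rw [this, h0, map_mul, hf i (by omega), ← mul_assoc, ← mul_assoc,
          mul_descProd hcomm hbraid k (by omega) hkn]
    have hmul : ∀ u w, F (u * w) = F u * F w := by
      intro u
      have hu : u ∈ Submonoid.closure
          (Set.range fun i : Fin n => swap i.castSucc i.succ) := by
        rw [Perm.mclosure_swap_castSucc_succ]; trivial
      induction hu using Submonoid.closure_induction with
      | mem x hx =>
        obtain ⟨i, rfl⟩ := hx
        intro w
        have h1 := key i (by omega) w
        have h2 := key i (by omega) 1
        rw [hF1, mul_one, mul_one] at h2
        exact h1.trans (congrArg (· * F w) h2.symm)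
      | one => intro w; rw [one_mul, hF1, one_mul]
      | mul x y _ _ hx hy =>
        intro w
        rw [mul_assoc, hx, hy, hx]
        exact (mul_assoc _ _ _).symm
    refine ⟨⟨⟨F, hF1⟩, hmul⟩, fun i h => ?_⟩
    have := key i h 1
    rwa [hF1, mul_one, mul_one] at this

end

/-! ### The homomorphism φ and its surjectivity -/

theorem antisymmetrizer_three_eq {A : Type*} [Ring A] {S T : A} (hS : S * S = 1) :
    1 - S - T + S * T + T * S - S * T * S = (1 - S) * (1 - T) * (1 - S) - (1 - S) := by
  have : (1 - S) * (1 - T) * (1 - S) - (1 - S) =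
    1 - S - T + S * T + T * S - S * T * S + (S * S - 1) := by noncomm_ring
  rw [this, hS, sub_self, add_zero]

theorem Equiv.swap_smul_finset {α : Type*} [DecidableEq α] {a b : α} {X : Finset α}
    (h : a ∈ X ↔ b ∈ X) : open Pointwise in swap a b • X = X := by
  open Pointwise in
  ext x
  rw [← Finset.inv_smul_mem_iff, swap_inv, Perm.smul_def, swap_apply_def]
  split_ifs with h1 h2
  · rw [h1, h]
  · rw [h2, h]
  · rfl

namespace TemperleyLieb

variable {n : ℕ}

theorem e_mul_self (i : Fin (n - 1)) : e i * e i = (2 : ℂ) • e i := by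
  have := RingQuot.mkAlgHom_rel ℂ (Rel.sq i)
  rwa [map_mul, map_smul] at this

theorem e_mul_comm {i j : Fin (n - 1)} (h : (i : ℕ) + 1 < j ∨ (j : ℕ) + 1 < i) :
    e i * e j = e j * e i := by
  have := RingQuot.mkAlgHom_rel ℂ (Rel.comm i j h)
  rwa [map_mul, map_mul] at this

theorem e_braid {i j : Fin (n - 1)} (h : (i : ℕ) + 1 = j ∨ (j : ℕ) + 1 = i) :
    e i * e j * e i = e i := by
  have := RingQuot.mkAlgHom_rel ℂ (Rel.braid i j h)
  rwa [map_mul, map_mul] at this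

theorem one_sub_e_sq (i : Fin (n - 1)) : (1 - e i) * (1 - e i) = 1 := by
  have h := e_mul_self i
  rw [two_smul] at h
  rw [mul_sub, mul_one, sub_mul, one_mul, h]
  abel

theorem one_sub_e_antisymmetrizer {i j : Fin (n - 1)} (h : (i : ℕ) + 1 = j ∨ (j : ℕ) + 1 = i) :
    1 - (1 - e i) - (1 - e j) + (1 - e i) * (1 - e j) + (1 - e j) * (1 - e i)
      - (1 - e i) * (1 - e j) * (1 - e i) = 0 := by
  rw [antisymmetrizer_three_eq (one_sub_e_sq i)]
  simp only [sub_sub_cancel]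
  rw [e_braid h, sub_self]

/-- The antisymmetrizers for (i, j) and (j, i) differ only in their longest term. -/
theorem one_sub_e_braid {i j : Fin (n - 1)} (h : (i : ℕ) + 1 = j ∨ (j : ℕ) + 1 = i) :
    (1 - e i) * (1 - e j) * (1 - e i) = (1 - e j) * (1 - e i) * (1 - e j) := by
  have h1 := sub_eq_zero.1 (one_sub_e_antisymmetrizer h)
  have h2 := sub_eq_zero.1 (one_sub_e_antisymmetrizer h.symm)
  rw [← h1, ← h2]
  abel

theorem exists_monoidHom (n : ℕ) :
    ∃ f : Perm (Fin n) →* TL n, ∀ i : Fin (n - 1), f (s i) = 1 - e i := by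
  obtain ⟨f, hf⟩ := Perm.exists_monoidHom_of_braid n
    (fun i => if h : i < n - 1 then (1 - e ⟨i, h⟩ : TL n) else 1)
    (fun i hi => by
      simp only [dif_pos (show i < n - 1 by omega), one_sub_e_sq])
    (fun i j hi hj => by
      simp only [dif_pos (show i < n - 1 by omega), dif_pos (show j < n - 1 by omega)]
      have := e_mul_comm (n := n) (i := ⟨i, by omega⟩) (j := ⟨j, by omega⟩) (Or.inl hi)
      simp only [mul_sub, sub_mul, this, one_mul, mul_one]
      abel)
    (fun i hi => by
      simp only [dif_pos (show i < n - 1 by omega), dif_pos (show i + 1 < n - 1 by omega)]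
      exact one_sub_e_braid (Or.inl rfl))
  refine ⟨f, fun i => ?_⟩
  have := hf i (by omega)
  rwa [dif_pos i.isLt] at this

/-- The algebra homomorphism `ℂ[S_n] → TL_n(2)` with `s_i ↦ 1 - e_i`. -/
noncomputable def fromPerm (n : ℕ) : MonoidAlgebra ℂ (Perm (Fin n)) →ₐ[ℂ] TL n :=
  MonoidAlgebra.lift ℂ _ _ (exists_monoidHom n).choose

theorem fromPerm_s (i : Fin (n - 1)) :
    fromPerm n (MonoidAlgebra.of ℂ _ (s i)) = 1 - e i := by
  rw [fromPerm, MonoidAlgebra.lift_of]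
  exact (exists_monoidHom n).choose_spec i

theorem mclosure_range_s (n : ℕ) : Submonoid.closure (Set.range (s (n := n))) = ⊤ := by
  cases n with
  | zero =>
    refine top_unique fun x _ => ?_
    rw [Subsingleton.elim x 1]
    exact Submonoid.one_mem _
  | succ n => exact Perm.mclosure_swap_castSucc_succ n

theorem algHom_ext_s {A : Type*} [Semiring A] [Algebra ℂ A]
    {f g : MonoidAlgebra ℂ (Perm (Fin n)) →ₐ[ℂ] A}
    (h : ∀ i : Fin (n - 1), f (MonoidAlgebra.of ℂ _ (s i)) = g (MonoidAlgebra.of ℂ _ (s i))) :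
    f = g := by
  refine (MonoidAlgebra.lift ℂ A (Perm (Fin n))).symm.injective ?_
  refine MonoidHom.eq_of_eqOn_denseM (mclosure_range_s n) ?_
  rintro _ ⟨i, rfl⟩
  exact h i

theorem adjoin_range_e (n : ℕ) : Algebra.adjoin ℂ (Set.range (e (n := n))) = ⊤ := by
  have h := congrArg (Subalgebra.map (RingQuot.mkAlgHom ℂ (Rel n)))
    (FreeAlgebra.adjoin_range_ι (R := ℂ) (X := Fin (n - 1)))
  rw [AlgHom.map_adjoin, Algebra.map_top,
    (AlgHom.range_eq_top _).2 (RingQuot.mkAlgHom_surjective ℂ _), ← Set.range_comp] at h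
  exact h

theorem fromPerm_surjective (n : ℕ) : Function.Surjective (fromPerm n) := by
  rw [← AlgHom.range_eq_top, ← top_le_iff, ← adjoin_range_e, Algebra.adjoin_le_iff]
  rintro _ ⟨i, rfl⟩
  refine ⟨1 - MonoidAlgebra.of ℂ _ (s i), ?_⟩
  change fromPerm n _ = _
  rw [map_sub, map_one, fromPerm_s, sub_sub_cancel]

/-! ### Action of the Temperley–Lieb algebra on functions on subsets -/

section

open Pointwise

/-- The permutation representation of `S_n` on the functions on the subsets of `Fin n`. -/
noncomputable def permRep (n : ℕ) : Perm (Fin n) →* Module.End ℂ (Finset (Fin n) → ℂ) where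
  toFun w := LinearMap.funLeft ℂ ℂ fun X => w⁻¹ • X
  map_one' := by ext; simp [LinearMap.funLeft_apply]
  map_mul' u v := by ext; simp [LinearMap.funLeft_apply, mul_smul]

theorem permRep_apply (w : Perm (Fin n)) (f : Finset (Fin n) → ℂ) (X : Finset (Fin n)) :
    permRep n w f X = f (w⁻¹ • X) := rfl

/-- Pigeonhole (Λ³ℂ² = 0): two of a, b, c are both in X or both outside it. Their transposition
fixes X, so the six terms cancel in pairs. -/
theorem permRep_antisymmetrizer {a b c : Fin n} (hab : a ≠ b) (hbc : b ≠ c) (hac : a ≠ c) :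
    1 - permRep n (swap a b) - permRep n (swap b c) + permRep n (swap a b) * permRep n (swap b c)
      + permRep n (swap b c) * permRep n (swap a b)
      - permRep n (swap a b) * permRep n (swap b c) * permRep n (swap a b) = 0 := by
  refine LinearMap.ext fun f => funext fun X => ?_
  simp only [LinearMap.sub_apply, LinearMap.add_apply, Module.End.mul_apply, Module.End.one_apply,
    LinearMap.zero_apply, Pi.sub_apply, Pi.add_apply, permRep_apply, Pi.zero_apply, swap_inv]
  have h13 : swap a b * swap b c * swap a b = swap a c := by
    rw [swap_comm a b, swap_comm b c, swap_mul_swap_mul_swap hbc.symm hac.symm]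
  have h31 : swap b c * swap a b * swap b c = swap a c := by
    rw [swap_mul_swap_mul_swap hab hac, swap_comm]
  have hs : swap a b • swap b c • swap a b • X = swap a c • X := by
    rw [smul_smul, smul_smul, h13]
  by_cases h1 : a ∈ X ↔ b ∈ X
  · rw [swap_smul_finset h1]; abel
  by_cases h2 : b ∈ X ↔ c ∈ X
  · rw [hs, ← h31, mul_smul, mul_smul, swap_smul_finset h2]; abel
  have h3 : swap a c • X = X := swap_smul_finset (by tauto)
  have h4 : swap a b • swap b c • X = swap b c • X := by
    nth_rw 2 [← h3]
    rw [← h31, smul_smul, smul_smul, mul_assoc (swap b c), ← mul_assoc (swap b c),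
      swap_mul_self, one_mul]
  have h5 : swap b c • swap a b • X = swap a b • X := by
    nth_rw 2 [← h3]
    rw [← h13, smul_smul, smul_smul, mul_assoc (swap a b), ← mul_assoc (swap a b),
      swap_mul_self, one_mul]
  rw [hs, h3, h4, h5]
  abel

theorem permRep_swap_sq (a b : Fin n) : permRep n (swap a b) * permRep n (swap a b) = 1 := by
  rw [← map_mul, swap_mul_self, map_one]

theorem exists_toPermRep (n : ℕ) :
    ∃ ρ : TL n →ₐ[ℂ] Module.End ℂ (Finset (Fin n) → ℂ), ∀ i, ρ (e i) = 1 - permRep n (s i) := by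
  refine ⟨RingQuot.liftAlgHom ℂ ⟨FreeAlgebra.lift ℂ fun i => 1 - permRep n (s i), ?_⟩, ?_⟩
  · rintro _ _ (⟨i⟩ | ⟨i, j, h⟩ | ⟨i, j, h⟩)
    · rw [map_mul, map_smul, FreeAlgebra.lift_ι_apply]
      simp only [two_smul, mul_sub, sub_mul, one_mul,
        mul_one, s, permRep_swap_sq]
      abel
    · have : s i * s j = s j * s i := by
        refine Perm.Disjoint.commute (Perm.disjoint_iff_disjoint_support.2 ?_)
        rw [s, s, Perm.support_swap (by simp), Perm.support_swap (by simp)]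
        simp only [Finset.disjoint_insert_left, Finset.disjoint_singleton_left, Finset.mem_insert,
          Finset.mem_singleton, Fin.mk.injEq]
        omega
      have hc : permRep n (s i) * permRep n (s j) = permRep n (s j) * permRep n (s i) := by
        rw [← map_mul, this, map_mul]
      simp only [map_mul, FreeAlgebra.lift_ι_apply, mul_sub, sub_mul, one_mul, mul_one, hc]
      abel
    · simp only [map_mul, FreeAlgebra.lift_ι_apply]
      rw [← sub_eq_zero, ← antisymmetrizer_three_eq (show permRep n (s i) * permRep n (s i) = 1 from
        permRep_swap_sq _ _)]
      have hi := i.isLt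
      have hj := j.isLt
      rcases h with h | h
      · have h' : (⟨i + 1, by omega⟩ : Fin n) = ⟨j, by omega⟩ := Fin.ext h
        have := permRep_antisymmetrizer (n := n) (a := ⟨i, by omega⟩) (b := ⟨j, by omega⟩)
          (c := ⟨j + 1, by omega⟩) (by simp; omega) (by simp) (by simp; omega)
        simpa only [s, h'] using this
      · have h' : (⟨j + 1, by omega⟩ : Fin n) = ⟨i, by omega⟩ := Fin.ext h
        have := permRep_antisymmetrizer (n := n) (a := ⟨i + 1, by omega⟩) (b := ⟨i, by omega⟩)
          (c := ⟨j, by omega⟩) (by simp) (by simp; omega) (by simp; omega)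
        simpa only [s, h', swap_comm] using this
  · intro i
    rw [e, RingQuot.liftAlgHom_mkAlgHom_apply, FreeAlgebra.lift_ι_apply]

/-- The representation of `TL_n(2)` on the functions on the subsets of `Fin n`. -/
noncomputable def toPermRep (n : ℕ) : TL n →ₐ[ℂ] Module.End ℂ (Finset (Fin n) → ℂ) :=
  (exists_toPermRep n).choose

theorem toPermRep_fromPerm (w : Perm (Fin n)) :
    toPermRep n (fromPerm n (MonoidAlgebra.of ℂ _ w)) = permRep n w := by
  have : (toPermRep n).comp (fromPerm n) = MonoidAlgebra.lift ℂ _ _ (permRep n) := by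
    refine algHom_ext_s fun i => ?_
    rw [AlgHom.comp_apply, fromPerm_s, map_sub, map_one, toPermRep,
      (exists_toPermRep n).choose_spec, sub_sub_cancel, MonoidAlgebra.lift_of]
  rw [← AlgHom.comp_apply, this, MonoidAlgebra.lift_of]

end

/-! ### Noncrossing partitions and their endpoints -/

theorem NCP.ext_arcs {p q : NCP n} (h : p.arcs = q.arcs) : p = q := by
  cases p; cases q; cases h; rfl

noncomputable instance NCP.instFintype : Fintype (NCP n) :=
  Fintype.ofInjective NCP.arcs fun _ _ => NCP.ext_arcs

theorem NCP.mem_left {p : NCP n} {i : Fin n} : i ∈ p.left ↔ ∃ j, (i, j) ∈ p.arcs := by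
  simp [NCP.left]

theorem NCP.mem_right {p : NCP n} {j : Fin n} : j ∈ p.right ↔ ∃ i, (i, j) ∈ p.arcs := by
  simp [NCP.right]

theorem NCP.injOn_fst (p : NCP n) : Set.InjOn Prod.fst (p.arcs : Set (Fin n × Fin n)) := by
  intro a ha b hb hab
  by_contra hne
  have h1 := p.noncrossing a ha b hb hne
  have h2 := p.noncrossing b hb a ha (Ne.symm hne)
  have h3 := p.lt_of_mem a ha
  have h4 := p.lt_of_mem b hb
  omega

theorem NCP.injOn_snd (p : NCP n) : Set.InjOn Prod.snd (p.arcs : Set (Fin n × Fin n)) := by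
  intro a ha b hb hab
  by_contra hne
  have h1 := p.noncrossing a ha b hb hne
  have h2 := p.noncrossing b hb a ha (Ne.symm hne)
  have h3 := p.lt_of_mem a ha
  have h4 := p.lt_of_mem b hb
  omega

/-- Suppose i < i'. In p, arcs starting in [i', j) must end before j; in q, arcs ending in (i', j]
must start in [i', j). Counting shared endpoints, there are at most as many right endpoints in (i',
j] as in (i', j), although j is one. -/
theorem NCP.not_lt_of_mem_of_mem {p q : NCP n} (hl : p.left = q.left) (hr : p.right = q.right)
    {i i' j : Fin n} (hp : (i, j) ∈ p.arcs) (hq : (i', j) ∈ q.arcs) : ¬ i < i' := by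
  intro hlt
  have hq' := q.lt_of_mem _ hq
  have h1 : (p.left.filter fun a => i' ≤ a ∧ a < j).card ≤
      (p.right.filter fun b => i' < b ∧ b < j).card := by
    calc _ ≤ ((p.arcs.filter fun x => i' ≤ x.1 ∧ x.1 < j).image Prod.fst).card := by
          refine Finset.card_le_card fun a ha => ?_
          rw [Finset.mem_filter, NCP.mem_left] at ha
          obtain ⟨⟨b, hb⟩, ha⟩ := ha
          exact Finset.mem_image.2 ⟨_, Finset.mem_filter.2 ⟨hb, ha⟩, rfl⟩
      _ ≤ (p.arcs.filter fun x => i' ≤ x.1 ∧ x.1 < j).card := Finset.card_image_le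
      _ = ((p.arcs.filter fun x => i' ≤ x.1 ∧ x.1 < j).image Prod.snd).card :=
          (Finset.card_image_of_injOn (p.injOn_snd.mono fun x hx => (Finset.mem_filter.1 hx).1)).symm
      _ ≤ _ := by
          refine Finset.card_le_card fun b hb => ?_
          simp only [Finset.mem_image, Finset.mem_filter] at hb
          obtain ⟨⟨a, b⟩, ⟨hab, h⟩, rfl⟩ := hb
          have h3 := p.lt_of_mem _ hab
          have h4 := fun hne => p.noncrossing _ hp _ hab hne
          simp only [ne_eq, Prod.mk.injEq] at h h3 h4
          refine Finset.mem_filter.2 ⟨NCP.mem_right.2 ⟨a, hab⟩, ?_, ?_⟩ <;> simp only <;> omega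
  have h2 : (q.right.filter fun b => i' < b ∧ b ≤ j).card ≤
      (q.left.filter fun a => i' ≤ a ∧ a < j).card := by
    calc _ ≤ ((q.arcs.filter fun x => i' < x.2 ∧ x.2 ≤ j).image Prod.snd).card := by
          refine Finset.card_le_card fun b hb => ?_
          rw [Finset.mem_filter, NCP.mem_right] at hb
          obtain ⟨⟨a, ha⟩, hb⟩ := hb
          exact Finset.mem_image.2 ⟨_, Finset.mem_filter.2 ⟨ha, hb⟩, rfl⟩
      _ ≤ (q.arcs.filter fun x => i' < x.2 ∧ x.2 ≤ j).card := Finset.card_image_le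
      _ = ((q.arcs.filter fun x => i' < x.2 ∧ x.2 ≤ j).image Prod.fst).card :=
          (Finset.card_image_of_injOn (q.injOn_fst.mono fun x hx => (Finset.mem_filter.1 hx).1)).symm
      _ ≤ _ := by
          refine Finset.card_le_card fun a ha => ?_
          simp only [Finset.mem_image, Finset.mem_filter] at ha
          obtain ⟨⟨a, b⟩, ⟨hab, h⟩, rfl⟩ := ha
          have h3 := q.lt_of_mem _ hab
          have h4 := fun hne => q.noncrossing _ hab _ hq hne
          simp only [ne_eq, Prod.mk.injEq] at h h3 h4
          refine Finset.mem_filter.2 ⟨NCP.mem_left.2 ⟨b, hab⟩, ?_, ?_⟩ <;> simp only <;> omega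
  have h3 : (q.right.filter fun b => i' < b ∧ b < j).card <
      (q.right.filter fun b => i' < b ∧ b ≤ j).card := by
    refine Finset.card_lt_card ((Finset.ssubset_iff_of_subset ?_).2 ⟨j, ?_, by simp⟩)
    · exact Finset.monotone_filter_right _ fun b _ hb => ⟨hb.1, hb.2.le⟩
    · exact Finset.mem_filter.2 ⟨NCP.mem_right.2 ⟨_, hq⟩, hq', le_rfl⟩
  rw [hl, hr] at h1
  omega

theorem NCP.arcs_subset {p q : NCP n} (hl : p.left = q.left) (hr : p.right = q.right) :
    p.arcs ⊆ q.arcs := by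
  rintro ⟨i, j⟩ h
  have : j ∈ q.right := hr ▸ NCP.mem_right.2 ⟨i, h⟩
  obtain ⟨i', h'⟩ := NCP.mem_right.1 this
  have h1 := NCP.not_lt_of_mem_of_mem hl hr h h'
  have h2 := NCP.not_lt_of_mem_of_mem hl.symm hr.symm h' h
  rwa [le_antisymm (not_lt.1 h2) (not_lt.1 h1)]

/-- A noncrossing partition is determined by its left and right endpoints. -/
theorem NCP.ext_left_right {p q : NCP n} (hl : p.left = q.left) (hr : p.right = q.right) :
    p = q :=
  NCP.ext_arcs ((NCP.arcs_subset hl hr).antisymm (NCP.arcs_subset hl.symm hr.symm))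

/-- Sets satisfying the ballot condition are the endpoint sets of a noncrossing partition. -/
theorem NCP.exists_of_ballot (L R : Finset (Fin n)) (hcard : L.card = R.card)
    (hb : ∀ k, (R.filter (· ≤ k)).card ≤ (L.filter (· < k)).card) :
    ∃ p : NCP n, p.left = L ∧ p.right = R := by
  induction hm : R.card generalizing L R with
  | zero =>
    rw [hm, Finset.card_eq_zero] at hcard
    rw [Finset.card_eq_zero] at hm
    exact ⟨⟨∅, by simp, by simp⟩, by simp [NCP.left, hcard], by simp [NCP.right, hm]⟩
  | succ m ih =>
    have hR : R.Nonempty := Finset.card_pos.1 (by omega)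
    -- Match the first right endpoint with the nearest left endpoint before it, then remove both.
    obtain ⟨j, hj, hjmin⟩ : ∃ j ∈ R, ∀ b ∈ R, j ≤ b :=
      ⟨R.min' hR, R.min'_mem hR, fun b hb => R.min'_le b hb⟩
    have hL : (L.filter (· < j)).Nonempty := by
      refine Finset.card_pos.1 (lt_of_lt_of_le (Finset.card_pos.2 ⟨j, ?_⟩) (hb j))
      simp [hj]
    obtain ⟨i, hi, himax⟩ : ∃ i ∈ L.filter (· < j), ∀ a ∈ L.filter (· < j), a ≤ i :=
      ⟨_, Finset.max'_mem _ hL, fun a ha => Finset.le_max' _ a ha⟩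
    rw [Finset.mem_filter] at hi
    obtain ⟨hiL, hij⟩ := hi
    have hmax : ∀ a ∈ L, a < j → a ≤ i := fun a ha h => himax a (Finset.mem_filter.2 ⟨ha, h⟩)
    obtain ⟨p, hpl, hpr⟩ := ih (L.erase i) (R.erase j)
      (by rw [Finset.card_erase_of_mem hiL, Finset.card_erase_of_mem hj, hcard])
      (fun k => by
        rcases lt_or_ge k j with hk | hk
        · rw [Finset.filter_eq_empty_iff.2, Finset.card_empty]
          · exact Nat.zero_le _
          · intro b hb'
            have := hjmin b (Finset.mem_of_mem_erase hb')
            omega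
        · rw [Finset.filter_erase, Finset.filter_erase,
            Finset.card_erase_of_mem (Finset.mem_filter.2 ⟨hj, show j ≤ k from hk⟩),
            Finset.card_erase_of_mem (Finset.mem_filter.2 ⟨hiL, show i < k by omega⟩)]
          exact Nat.sub_le_sub_right (hb k) 1)
      (by rw [Finset.card_erase_of_mem hj, hm]; rfl)
    have hp : ∀ x ∈ p.arcs, x.1 ∈ L ∧ x.1 ≠ i ∧ j < x.2 := by
      intro x hx
      have h1 : x.1 ∈ L.erase i := hpl ▸ NCP.mem_left.2 ⟨x.2, hx⟩
      have h2 : x.2 ∈ R.erase j := hpr ▸ NCP.mem_right.2 ⟨x.1, hx⟩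
      rw [Finset.mem_erase] at h1 h2
      exact ⟨h1.2, h1.1, lt_of_le_of_ne (hjmin _ h2.2) (Ne.symm h2.1)⟩
    refine ⟨⟨insert (i, j) p.arcs, ?_, ?_⟩, ?_, ?_⟩
    · intro a ha
      rcases Finset.mem_insert.1 ha with rfl | ha
      · exact hij
      · exact p.lt_of_mem a ha
    · intro a ha b hb hne
      rcases Finset.mem_insert.1 ha with rfl | ha <;> rcases Finset.mem_insert.1 hb with rfl | hb
      · exact absurd rfl hne
      · rintro ⟨h1, h2, -⟩
        obtain ⟨h3, h4, -⟩ := hp b hb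
        exact h4 (le_antisymm (hmax _ h3 h2) h1)
      · rintro ⟨-, -, h1⟩
        exact absurd (hp a ha).2.2 (not_lt.2 h1)
      · exact p.noncrossing a ha b hb hne
    · change Finset.image _ (insert _ _) = _
      rw [Finset.image_insert]
      change insert i p.left = L
      rw [hpl, Finset.insert_erase hiL]
    · change Finset.image _ (insert _ _) = _
      rw [Finset.image_insert]
      change insert j p.right = R
      rw [hpr, Finset.insert_erase hj]

/-! ### Excedance classes and linear independence -/

theorem mem_excPos {w : Perm (Fin n)} {i : Fin n} : i ∈ excPos w ↔ i ≤ w i := by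
  simp [excPos]

theorem apply_mem_excVal {w : Perm (Fin n)} {i : Fin n} : w i ∈ excVal w ↔ i ∈ excPos w := by
  simp [excVal]

theorem exists_mem_excClass (w : Perm (Fin n)) : ∃ p : NCP n, w ∈ excClass p := by
  obtain ⟨p, hl, hr⟩ := NCP.exists_of_ballot (excVal w)ᶜ (excPos w)ᶜ
    (by rw [Finset.card_compl, Finset.card_compl, excVal,
      Finset.card_image_of_injective _ w.injective])
    (fun k => by
      -- A position that is not a weak excedance has w b < b, which is the ballot condition.
      refine Finset.card_le_card_of_injOn w (fun b hb => ?_) w.injective.injOn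
      simp only [Finset.coe_filter, Finset.mem_compl, Set.mem_ofPred_eq, apply_mem_excVal] at hb ⊢
      refine ⟨hb.1, ?_⟩
      rw [mem_excPos] at hb
      omega)
  exact ⟨p, by rw [hl, compl_compl], by rw [hr, compl_compl]⟩

/-- If `w` maps `X` onto `Y` then the excess of `X` over `Y` with respect to suitable pairs of
initial segments is at most that of the weak excedance positions over the values. -/
theorem card_filter_add_le {w : Perm (Fin n)} {X Y : Finset (Fin n)} (hXY : X.image w = Y)
    (P Q : Fin n → Prop) [DecidablePred P] [DecidablePred Q]
    (h1 : ∀ x, x ≤ w x → Q (w x) → P x) (h2 : ∀ x, P x → ¬ Q (w x) → x ≤ w x) :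
    (X.filter P).card + ((excVal w).filter Q).card ≤
      ((excPos w).filter P).card + (Y.filter Q).card := by
  -- Elements leaving (P x but not Q (w x)) are all weak excedances, and no weak excedance enters;
  -- so the excedance positions maximize the net outflow.
  have hXP : (X.filter P).card ≤
      (Y.filter Q).card + (((excPos w).filter P).filter fun x => ¬ Q (w x)).card := by
    rw [← Finset.card_filter_add_card_filter_not (s := X.filter P) fun x => Q (w x)]
    refine add_le_add (Finset.card_le_card_of_injOn w (fun x hx => ?_) w.injective.injOn)
      (Finset.card_le_card fun x hx => ?_)
    · simp only [Finset.mem_coe, Finset.mem_filter] at hx ⊢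
      exact ⟨hXY ▸ Finset.mem_image_of_mem w hx.1.1, hx.2⟩
    · simp only [Finset.mem_filter, mem_excPos] at hx ⊢
      exact ⟨⟨h2 x hx.1.2 hx.2, hx.1.2⟩, hx.2⟩
  have hQ : ((excVal w).filter Q).card ≤
      (((excPos w).filter P).filter fun x => Q (w x)).card := by
    rw [excVal, Finset.filter_image, Finset.card_image_of_injective _ w.injective]
    refine Finset.card_le_card fun x hx => ?_
    simp only [Finset.mem_filter, mem_excPos] at hx ⊢
    exact ⟨⟨hx.1, h1 x hx.1 hx.2⟩, hx.2⟩
  have := Finset.card_filter_add_card_filter_not (s := (excPos w).filter P) fun x => Q (w x)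
  omega

/-- The excesses of the complement of the right endpoints over the complement of the left
endpoints with respect to pairs of initial segments. -/
def NCP.excess (p : NCP n) (k : Fin n) : ℤ × ℤ × ℤ :=
  ((p.rightᶜ.filter (· ≤ k)).card - (p.leftᶜ.filter (· ≤ k)).card,
    (p.rightᶜ.filter (· ≤ k)).card - (p.leftᶜ.filter (· < k)).card,
    (p.rightᶜ.filter (· < k)).card - (p.leftᶜ.filter (· < k)).card)

theorem card_filter_le_eq (X : Finset (Fin n)) (k : Fin n) :
    (X.filter (· ≤ k)).card = (X.filter (· < k)).card + if k ∈ X then 1 else 0 := by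
  split_ifs with h
  · rw [← Finset.card_insert_of_notMem (a := k) (by simp)]
    congr 1
    ext x
    simp only [Finset.mem_filter, Finset.mem_insert, le_iff_lt_or_eq]
    constructor
    · rintro ⟨hx, hk | rfl⟩
      · exact Or.inr ⟨hx, hk⟩
      · exact Or.inl rfl
    · rintro (rfl | ⟨hx, hk⟩)
      · exact ⟨h, Or.inr rfl⟩
      · exact ⟨hx, Or.inl hk⟩
  · rw [add_zero]
    congr 1
    refine Finset.filter_congr fun x hx => ?_
    have : x ≠ k := fun hxk => h (hxk ▸ hx)
    exact ⟨fun hk => lt_of_le_of_ne hk this, le_of_lt⟩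

/-- Differences of consecutive components at k are the indicators of k not being a left,
respectively right, endpoint. -/
theorem NCP.excess_injective : Function.Injective (NCP.excess (n := n)) := by
  intro p q h
  have key : ∀ k, (k ∈ p.left ↔ k ∈ q.left) ∧ (k ∈ p.right ↔ k ∈ q.right) := by
    intro k
    have hk := congrFun h k
    simp only [NCP.excess, Prod.mk.injEq, card_filter_le_eq, Finset.mem_compl] at hk
    obtain ⟨h1, h2, h3⟩ := hk
    constructor
    · by_cases ha : k ∈ p.left <;> by_cases hb : k ∈ q.left <;> simp [ha, hb] at h1 h2 ⊢ <;> omega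
    · by_cases ha : k ∈ p.right <;> by_cases hb : k ∈ q.right <;>
        simp [ha, hb] at h2 h3 ⊢ <;> omega
  exact NCP.ext_left_right (Finset.ext fun k => (key k).1) (Finset.ext fun k => (key k).2)

theorem NCP.excess_le {p q : NCP n} {w : Perm (Fin n)} (hw : w ∈ excClass p)
    (h : q.rightᶜ.image w = q.leftᶜ) : q.excess ≤ p.excess := by
  intro k
  have h1 := card_filter_add_le h (· ≤ k) (· ≤ k) (fun x _ _ => by omega)
    (fun x _ _ => by omega)
  have h2 := card_filter_add_le h (· ≤ k) (· < k) (fun x _ _ => by omega)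
    (fun x _ _ => by omega)
  have h3 := card_filter_add_le h (· < k) (· < k) (fun x _ _ => by omega)
    (fun x _ _ => by omega)
  rw [hw.1, hw.2] at h1 h2 h3
  refine ⟨?_, ?_, ?_⟩ <;> simp only [NCP.excess] <;> omega

theorem linearIndependent_fromPerm {w : NCP n → Perm (Fin n)} (hw : ∀ p, w p ∈ excClass p) :
    LinearIndependent ℂ fun p => fromPerm n (MonoidAlgebra.of ℂ _ (w p)) := by
  open Pointwise in
  rw [Fintype.linearIndependent_iff]
  intro c hc
  by_contra! hne
  obtain ⟨q, hq, hmax⟩ := Finset.exists_maximalFor NCP.excess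
    (Finset.univ.filter fun p => c p ≠ 0) (by
      obtain ⟨p, hp⟩ := hne
      exact ⟨p, by simpa using hp⟩)
  have hq' : c q ≠ 0 := by simpa using hq
  have himage : ∀ (u : Perm (Fin n)) (X : Finset (Fin n)), X.image u = u • X := fun _ _ => rfl
  -- Among partitions with nonzero coefficient, q has maximal excess, so this matrix entry isolates
  -- c q.
  have h := congrArg (fun x => toPermRep n x (Pi.single q.rightᶜ 1) q.leftᶜ) hc
  simp only [map_sum, map_smul, toPermRep_fromPerm, LinearMap.sum_apply, Finset.sum_apply,
    LinearMap.smul_apply, Pi.smul_apply, permRep_apply, map_zero, LinearMap.zero_apply,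
    Pi.zero_apply, smul_eq_mul] at h
  rw [Finset.sum_eq_single q] at h
  · refine hq' ?_
    have : (w q)⁻¹ • q.leftᶜ = q.rightᶜ := by
      rw [inv_smul_eq_iff, ← himage, ← (hw q).1, ← (hw q).2, excVal]
    rwa [this, Pi.single_eq_same, mul_one] at h
  · intro p _ hpq
    by_cases hp : c p = 0
    · rw [hp, zero_mul]
    · rw [Pi.single_eq_of_ne, mul_zero]
      intro heq
      rw [inv_smul_eq_iff, ← himage] at heq
      have hle := NCP.excess_le (hw p) heq.symm
      exact hpq (NCP.excess_injective (le_antisymm (hmax (by simpa using hp) hle) hle))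
  · simp

end TemperleyLieb

/-! ### Spanning by 321-avoiding permutations and the dimension bound -/

theorem Equiv.Perm.exists_apply_eq_of_ne {α : Type*} {x y z a b c : α} (hxy : x ≠ y) (hyz : y ≠ z)
    (hxz : x ≠ z) (hab : a ≠ b) (hbc : b ≠ c) (hac : a ≠ c) :
    ∃ u : Perm α, u x = a ∧ u y = b ∧ u z = c := by
  classical
  have h1 : ∀ d, d ≠ a → swap x a d ≠ x := fun d hd h => hd (by
    rw [← swap_apply_self x a d, h, swap_apply_left])
  set u := swap x a * swap y (swap x a b) with hu
  have hx : u x = a := by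
    rw [hu, Perm.mul_apply, swap_apply_of_ne_of_ne hxy (h1 b hab.symm).symm, swap_apply_left]
  have hy : u y = b := by rw [hu, Perm.mul_apply, swap_apply_left, swap_apply_self]
  refine ⟨u * swap z (u⁻¹ c), ?_, ?_, ?_⟩ <;> rw [Perm.mul_apply]
  · rw [swap_apply_of_ne_of_ne hxz, hx]
    rw [ne_eq, Perm.eq_inv_iff_eq, hx]
    exact hac
  · rw [swap_apply_of_ne_of_ne hyz, hy]
    rw [ne_eq, Perm.eq_inv_iff_eq, hy]
    exact hbc
  · rw [swap_apply_left]
    exact u.apply_symm_apply c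

namespace TemperleyLieb

variable {n : ℕ}

/-- The image in `TL_n(2)` of a permutation. -/
noncomputable def permToTL (n : ℕ) : Perm (Fin n) →* TL n :=
  (fromPerm n : MonoidAlgebra ℂ (Perm (Fin n)) →* TL n).comp (MonoidAlgebra.of ℂ _)

theorem permToTL_apply (w : Perm (Fin n)) :
    permToTL n w = fromPerm n (MonoidAlgebra.of ℂ _ w) := rfl

theorem permToTL_antisymmetrizer {a b c : Fin n} (hab : a ≠ b) (hbc : b ≠ c) (hac : a ≠ c) :
    1 - permToTL n (swap a b) - permToTL n (swap b c)
      + permToTL n (swap a b * swap b c) + permToTL n (swap b c * swap a b)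
      - permToTL n (swap a b * swap b c * swap a b) = 0 := by
  have hn : 2 < n := by
    have := a.isLt; have := b.isLt; have := c.isLt
    omega
  obtain ⟨u, rfl, rfl, rfl⟩ := Perm.exists_apply_eq_of_ne
    (x := (⟨0, by omega⟩ : Fin n)) (y := ⟨1, by omega⟩) (z := ⟨2, hn⟩)
    (by simp) (by simp) (by simp) hab hbc hac
  have h := one_sub_e_antisymmetrizer (n := n) (i := ⟨0, by omega⟩) (j := ⟨1, by omega⟩)
    (Or.inl rfl)
  rw [← fromPerm_s, ← fromPerm_s, ← permToTL_apply, ← permToTL_apply] at h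
  -- Conjugation carries the relation from the letters 0, 1, 2 to arbitrary distinct letters.
  have h' := congrArg (fun x => permToTL n u * x * permToTL n u⁻¹) h
  simp only [mul_zero, zero_mul, mul_sub, mul_add, sub_mul, add_mul, mul_one, ← map_mul,
    mul_inv_cancel, map_one] at h'
  rw [swap_apply_apply, swap_apply_apply]
  simpa only [s, mul_assoc, inv_mul_cancel_left, zero_add] using h'

/-- A permutation is `321`-avoiding. -/
def Avoids321 (w : Perm (Fin n)) : Prop :=
  ∀ i j k, i < j → j < k → w j < w i → ¬ w k < w j

theorem sum_mul_lt_of_swap (w : Perm (Fin n)) {a b : Fin n} (hab : a < b) (h : w b < w a) :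
    ∑ x : Fin n, (x : ℕ) * (w x : ℕ) < ∑ x : Fin n, (x : ℕ) * ((w * swap a b) x : ℕ) := by
  have key : ∀ f : Fin n → ℕ,
      ∑ x, f x = f a + (f b + ∑ x ∈ (Finset.univ.erase a).erase b, f x) := by
    intro f
    rw [Finset.add_sum_erase _ _ (Finset.mem_erase.2 ⟨hab.ne', Finset.mem_univ _⟩),
      Finset.add_sum_erase _ _ (Finset.mem_univ _)]
  rw [key, key fun x : Fin n => (x : ℕ) * ((w * swap a b) x : ℕ)]
  have hrest : ∑ x ∈ (Finset.univ.erase a).erase b, (x : ℕ) * ((w * swap a b) x : ℕ) =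
      ∑ x ∈ (Finset.univ.erase a).erase b, (x : ℕ) * (w x : ℕ) := by
    refine Finset.sum_congr rfl fun x hx => ?_
    simp only [Finset.mem_erase] at hx
    rw [Perm.mul_apply, swap_apply_of_ne_of_ne hx.2.1 hx.1]
  rw [hrest, Perm.mul_apply, Perm.mul_apply, swap_apply_left, swap_apply_right]
  have h1 : (a : ℕ) < b := hab
  have h2 : (w b : ℕ) < w a := h
  nlinarith

/-- At a 321 pattern, the antisymmetrizer relation expresses w through its five other rearrangements
at these positions. Each is reached by undoing inversions, so it has larger ∑ x · w x; a
counterexample maximizing this sum is impossible. -/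
theorem permToTL_mem_span (w : Perm (Fin n)) :
    permToTL n w ∈ Submodule.span ℂ (permToTL n '' {v | Avoids321 v}) := by
  by_contra hw
  classical
  obtain ⟨w, hw, hmax⟩ := Finset.exists_max_image (Finset.univ.filter fun v =>
      permToTL n v ∉ Submodule.span ℂ (permToTL n '' {v | Avoids321 v}))
    (fun v => ∑ x : Fin n, (x : ℕ) * (v x : ℕ)) ⟨w, by simpa using hw⟩
  simp only [Finset.mem_filter, Finset.mem_univ, true_and] at hw hmax
  have hmem : ∀ v : Perm (Fin n),
      ∑ x : Fin n, (x : ℕ) * (w x : ℕ) < ∑ x : Fin n, (x : ℕ) * (v x : ℕ) →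
      permToTL n v ∈ Submodule.span ℂ (permToTL n '' {v | Avoids321 v}) := by
    intro v hv
    by_contra h
    exact absurd (hmax v h) (not_le.2 hv)
  by_cases ha : Avoids321 w
  · exact hw (Submodule.subset_span ⟨w, ha, rfl⟩)
  simp only [Avoids321, not_forall, not_not] at ha
  obtain ⟨i, j, k, hij, hjk, h1, h2⟩ := ha
  have hik := hij.trans hjk
  have ws := sum_mul_lt_of_swap w hij h1
  have wt := sum_mul_lt_of_swap w hjk h2
  have wst := sum_mul_lt_of_swap (w * swap i j) hjk (by
    rw [Perm.mul_apply, Perm.mul_apply, swap_apply_right, swap_apply_of_ne_of_ne hik.ne' hjk.ne']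
    exact h2.trans h1)
  have wts := sum_mul_lt_of_swap (w * swap j k) hij (by
    rw [Perm.mul_apply, Perm.mul_apply, swap_apply_left, swap_apply_of_ne_of_ne hij.ne hik.ne]
    exact h2.trans h1)
  have wsts := sum_mul_lt_of_swap (w * swap i j * swap j k) hij (by
    simp only [Perm.mul_apply]
    rw [swap_apply_left j k, swap_apply_of_ne_of_ne hik.ne' hjk.ne',
      swap_apply_of_ne_of_ne hij.ne hik.ne, swap_apply_left]
    exact h2)
  have h := congrArg (permToTL n w * ·) (permToTL_antisymmetrizer hij.ne hjk.ne hik.ne)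
  simp only [mul_zero, mul_sub, mul_add, mul_one, ← map_mul, ← mul_assoc] at h
  refine hw ?_
  have heq : permToTL n w = permToTL n (w * swap i j) + permToTL n (w * swap j k)
      - permToTL n (w * swap i j * swap j k) - permToTL n (w * swap j k * swap i j)
      + permToTL n (w * swap i j * swap j k * swap i j) := by
    rw [← sub_eq_zero, ← h]
    abel
  rw [heq]
  exact add_mem (sub_mem (sub_mem (add_mem (hmem _ ws) (hmem _ wt)) (hmem _ (ws.trans wst)))
    (hmem _ (wt.trans wts))) (hmem _ (ws.trans (wst.trans wsts)))

theorem span_permToTL_avoids321 (n : ℕ) :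
    Submodule.span ℂ (permToTL n '' {v | Avoids321 v}) = ⊤ := by
  rw [← top_le_iff]
  rintro x -
  obtain ⟨y, rfl⟩ := fromPerm_surjective n x
  induction y using MonoidAlgebra.induction_on with
  | of w => exact permToTL_mem_span w
  | add a b ha hb => rw [map_add]; exact add_mem ha hb
  | smul r a ha => rw [map_smul]; exact Submodule.smul_mem _ r ha

theorem Avoids321.strictMonoOn_excPos {w : Perm (Fin n)} (h : Avoids321 w) :
    StrictMonoOn w (excPos w : Set (Fin n)) := by
  intro i hi j hj hij
  rw [Finset.mem_coe, mem_excPos] at hi hj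
  by_contra hlt
  have hlt : w j < w i := lt_of_le_of_ne (not_lt.1 hlt) fun h => hij.ne' (w.injective h)
  -- Without a 321 pattern, every value below w j sits before j and not at i, so w j ≤ j - 1,
  -- contradicting j ≤ w j.
  have := Finset.card_le_card_of_injOn (s := Finset.Iio (w j)) (t := (Finset.Iio j).erase i) w.symm
    (fun y hy => by
      obtain ⟨x, rfl⟩ := w.surjective y
      rw [Finset.mem_coe, Finset.mem_Iio] at hy
      rw [symm_apply_apply, Finset.mem_coe, Finset.mem_erase, Finset.mem_Iio]
      refine ⟨fun hx => ?_, ?_⟩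
      · subst hx; omega
      · by_contra hx
        rcases (not_lt.1 hx).eq_or_lt with rfl | hx
        · exact lt_irrefl _ hy
        · exact h i j x hij hx hlt hy) w.symm.injective.injOn
  rw [Finset.card_erase_of_mem (Finset.mem_Iio.2 hij), Fin.card_Iio, Fin.card_Iio] at this
  omega

theorem Avoids321.strictMonoOn_compl_excPos {w : Perm (Fin n)} (h : Avoids321 w) :
    StrictMonoOn w ((excPos w)ᶜ : Finset (Fin n)) := by
  intro i hi j hj hij
  rw [Finset.mem_coe, Finset.mem_compl, mem_excPos] at hi hj
  by_contra hlt
  have hlt : w j < w i := lt_of_le_of_ne (not_lt.1 hlt) fun h => hij.ne' (w.injective h)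
  -- Dually, positions before i carry values below w i other than w j, so i ≤ w i - 1, contradicting
  -- w i < i.
  have := Finset.card_le_card_of_injOn (s := Finset.Iio i) (t := (Finset.Iio (w i)).erase (w j)) w
    (fun x hx => by
      rw [Finset.mem_coe, Finset.mem_Iio] at hx
      rw [Finset.mem_coe, Finset.mem_erase, Finset.mem_Iio]
      refine ⟨fun hxj => ?_, ?_⟩
      · have := w.injective hxj
        omega
      · by_contra hx'
        refine h x i j hx hij (lt_of_le_of_ne (not_lt.1 hx') fun hxi => hx.ne' (w.injective hxi))
          hlt) w.injective.injOn
  rw [Finset.card_erase_of_mem (Finset.mem_Iio.2 hlt), Fin.card_Iio, Fin.card_Iio] at this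
  omega

theorem eqOn_of_strictMonoOn_of_image_eq {α β : Type*} [LinearOrder α] [WellFoundedLT α]
    [LinearOrder β] {f g : α → β} {S : Set α} (hf : StrictMonoOn f S) (hg : StrictMonoOn g S)
    (h : f '' S = g '' S) : Set.EqOn f g S := by
  intro x
  induction x using WellFoundedLT.induction with
  | ind x ih =>
    intro hx
    rcases lt_trichotomy (f x) (g x) with hlt | heq | hlt
    · obtain ⟨y, hy, hyx⟩ : f x ∈ g '' S := h ▸ ⟨x, hx, rfl⟩
      have hyx' : y < x := (hg.lt_iff_lt hy hx).1 (hyx ▸ hlt)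
      exact absurd (hf.injOn hy hx ((ih y hyx' hy).trans hyx)) hyx'.ne
    · exact heq
    · obtain ⟨y, hy, hyx⟩ : g x ∈ f '' S := h ▸ ⟨x, hx, rfl⟩
      have hyx' : y < x := (hf.lt_iff_lt hy hx).1 (hyx ▸ hlt)
      exact absurd (hg.injOn hy hx ((ih y hyx' hy).symm.trans hyx)) hyx'.ne

theorem image_compl_excPos (w : Perm (Fin n)) :
    w '' ((excPos w)ᶜ : Finset (Fin n)) = ((excVal w)ᶜ : Finset (Fin n)) := by
  rw [Finset.coe_compl, Finset.coe_compl, Set.image_compl_eq w.bijective, excVal, Finset.coe_image]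

theorem Avoids321.eq_of_exc_eq {v w : Perm (Fin n)} (hv : Avoids321 v) (hw : Avoids321 w)
    (hpos : excPos v = excPos w) (hval : excVal v = excVal w) : v = w := by
  ext1 x
  by_cases hx : x ∈ excPos v
  · refine eqOn_of_strictMonoOn_of_image_eq hv.strictMonoOn_excPos
      (hpos ▸ hw.strictMonoOn_excPos) ?_ hx
    rw [← Finset.coe_image, ← excVal, hval, hpos, excVal, Finset.coe_image]
  · refine eqOn_of_strictMonoOn_of_image_eq hv.strictMonoOn_compl_excPos
      (hpos ▸ hw.strictMonoOn_compl_excPos) ?_ (by simpa using hx)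
    rw [image_compl_excPos, hval, hpos, image_compl_excPos]

theorem ncard_avoids321_le (n : ℕ) :
    {v : Perm (Fin n) | Avoids321 v}.ncard ≤ Fintype.card (NCP n) := by
  choose p hp using exists_mem_excClass (n := n)
  rw [← Nat.card_eq_fintype_card, ← Set.ncard_univ]
  refine Set.ncard_le_ncard_of_injOn p (fun _ _ => Set.mem_univ _) fun v hv w hw hvw => ?_
  refine Avoids321.eq_of_exc_eq hv hw ?_ ?_
  · rw [(hp v).2, (hp w).2, hvw]
  · rw [(hp v).1, (hp w).1, hvw]

instance : Module.Finite ℂ (TL n) :=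
  ⟨Submodule.fg_def.2 ⟨_, (Set.toFinite _).image _, span_permToTL_avoids321 n⟩⟩

theorem finrank_le_card (n : ℕ) : Module.finrank ℂ (TL n) ≤ Fintype.card (NCP n) := by
  classical
  have hfin : (permToTL n '' {v | Avoids321 v}).Finite := (Set.toFinite _).image _
  let _ := hfin.fintype
  have h := finrank_span_le_card (R := ℂ) (permToTL n '' {v | Avoids321 v})
  rw [span_permToTL_avoids321, finrank_top, ← Set.ncard_eq_toFinset_card'] at h
  exact h.trans ((Set.ncard_image_le (Set.toFinite _)).trans (ncard_avoids321_le n))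

end TemperleyLieb

theorem mainTheorem3 (n : ℕ) :
    ∃ φ : MonoidAlgebra ℂ (Equiv.Perm (Fin n)) →ₐ[ℂ] TemperleyLieb.TL n,
      (∀ i : Fin (n - 1),
        φ (MonoidAlgebra.of ℂ _ (TemperleyLieb.s i)) = 1 - TemperleyLieb.e i) ∧
      (∀ ψ : MonoidAlgebra ℂ (Equiv.Perm (Fin n)) →ₐ[ℂ] TemperleyLieb.TL n,
        (∀ i : Fin (n - 1),
          ψ (MonoidAlgebra.of ℂ _ (TemperleyLieb.s i)) = 1 - TemperleyLieb.e i) → ψ = φ) ∧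
      Function.Surjective φ ∧
      ∀ w : TemperleyLieb.NCP n → Equiv.Perm (Fin n),
        (∀ p, w p ∈ TemperleyLieb.excClass p) →
        ∃ b : Module.Basis (TemperleyLieb.NCP n) ℂ (TemperleyLieb.TL n),
          ∀ p, b p = φ (MonoidAlgebra.of ℂ _ (w p)) := by
  open TemperleyLieb in
  refine ⟨fromPerm n, fromPerm_s, fun ψ hψ => algHom_ext_s fun i => ?_, fromPerm_surjective n,
    fun w hw => ?_⟩
  · rw [hψ, fromPerm_s]
  · have hli := linearIndependent_fromPerm hw
    have hspan := hli.span_eq_top_of_card_eq_finrank'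
      (le_antisymm hli.fintype_card_le_finrank (finrank_le_card n))
    exact ⟨Module.Basis.mk hli hspan.ge, fun p => by rw [Module.Basis.mk_apply]⟩
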